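/- Let $N\ge 1$ be an integer and $a>-1$ a real number. Consider the fixed trace Laguerre unitary ensemble, i.e. the probability distribution of $(\lambda_1,\dots,\lambda_N)$ with density $$ \frac1{C_{N,a}}\;\delta\Big(1-\sum_{l=1}^N\lambda_l\Big)\prod_{l=1}^N\lambda_l^{a}\prod_{1\le j<k\le N}(\lambda_k-\lambda_j)^2,\qquad \lambda_l>0, $$ where $C_{N,a}\in(0,\infty)$ is the normalisation constant. Write $\kappa_n$ for the $n$-th cumulant of the purity $\sum_{j=1}^N\lambda_j^2$, that is, $\kappa_n=\frac{d^n}{dt^n}\log\big\langle e^{t\sum_j\lambda_j^2}\big\rangle\big|_{t=0}$, where $\langle\cdot\rangle$ is the expectation. Then $$ \kappa_1=\frac{2N+a}{N(N+a)+1}, $$ $$ \kappa_2=\frac{2(N^2-1)\big((N+a)^2-1\big)}{(N(N+a)+1)^2(N(N+a)+2)(N(N+a)+3)}, $$ $$ \kappa_3=\frac{8(N^2-1)\big((N+a)^2-1\big)(2N+a)\,(N(N+a)-5)}{(N(N+a)+1)^3(N(N+a)+2)(N(N+a)+3)(N(N+a)+4)(N(N+a)+5)}. $$ -/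

import Mathlib

open MeasureTheory

/-- The embedding `(x₂, …, x_N) ↦ (1 - ∑ xᵢ, x₂, …, x_N)`, which parametrises the hyperplane
`∑ λ_l = 1` in `ℝ^N`, `N = M + 1`, by all coordinates but the first. -/
def traceOnePoint {M : ℕ} (x : Fin M → ℝ) : Fin (M + 1) → ℝ :=
  Fin.cons (1 - ∑ i, x i) x

theorem measurable_traceOnePoint {M : ℕ} :
    Measurable (traceOnePoint : (Fin M → ℝ) → Fin (M + 1) → ℝ) := by
  refine measurable_pi_lambda _ fun i => ?_
  refine Fin.cases ?_ (fun j => ?_) i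
  · simp only [traceOnePoint, Fin.cons_zero]
    fun_prop
  · simp only [traceOnePoint, Fin.cons_succ]
    fun_prop

/-- The measure `δ(1 - ∑ λ_l) dλ₁ ⋯ dλ_N` on `ℝ^N`: integrating out `λ₁` against the Dirac delta
leaves Lebesgue measure in the other coordinates, with `λ₁ = 1 - λ₂ - ⋯ - λ_N`.
The value at `N = 0` is a convention; only `N ≥ 1` is of interest. -/
noncomputable def traceOneMeasure : (N : ℕ) → Measure (Fin N → ℝ)
  | 0 => 0
  | _ + 1 => Measure.map traceOnePoint volume

/-- `∏ λ_l ^ a ∏_{j < k} (λ_k - λ_j) ^ 2`, the unnormalised weight. -/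
noncomputable def laguerreWeight {N : ℕ} (a : ℝ) (x : Fin N → ℝ) : ℝ :=
  (∏ l, x l ^ a) * ∏ j, ∏ k ∈ Finset.Ioi j, (x k - x j) ^ 2

/-- The unnormalised measure
`δ(1 - ∑ λ_l) ∏ λ_l ^ a ∏_{j < k} (λ_k - λ_j) ^ 2 dλ₁ ⋯ dλ_N` on `{λ_l > 0}`. -/
noncomputable def fixedTraceLUEUnnormalized (N : ℕ) (a : ℝ) : Measure (Fin N → ℝ) :=
  ((traceOneMeasure N).restrict {x | ∀ l, 0 < x l}).withDensity
    fun x => ENNReal.ofReal (laguerreWeight a x)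

/-- The eigenvalue distribution of the fixed trace Laguerre unitary ensemble. -/
noncomputable def fixedTraceLUE (N : ℕ) (a : ℝ) : Measure (Fin N → ℝ) :=
  (fixedTraceLUEUnnormalized N a Set.univ)⁻¹ • fixedTraceLUEUnnormalized N a

/-- The purity `∑ λ_j ^ 2`. -/
def purity {N : ℕ} (x : Fin N → ℝ) : ℝ := ∑ j, x j ^ 2

/-- The `n`-th cumulant of `X` under `μ`: the `n`-th derivative at `0` of the cumulant generating
function `t ↦ log E[exp (t X)]`, i.e. `n!` times its `n`-th Taylor coefficient. -/
noncomputable def cumulant {Ω : Type*} [MeasurableSpace Ω] (X : Ω → ℝ) (μ : Measure Ω)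
    (n : ℕ) : ℝ :=
  iteratedDeriv n (ProbabilityTheory.cgf X μ) 0

/-! The Dirichlet integral says that a monomial integrated over the simplex equals its integral
against `∏ exp (-xᵢ)` on the orthant, divided by a Gamma value depending only on the total degree.
Hence, with `d = N(N+a)`, the `n`-th moment of the purity is the Laguerre ensemble average of `p₂ ^
n`, where `p_k` are the power sums, times `Γ(d) / Γ(d+2n)` (`integral_fixedTraceLUE_purity_pow`).

The Laguerre averages need no integrals: they come from a linear functional on polynomials for which
`Γ(s+1) = sΓ(s)` plays the role of integration by parts. Applied along `∑ xᵢ^(k+1) ∂ᵢ` to the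
squared Vandermonde times `F`, it yields the loop equations `laguerreFunctional_psum_succ_mul`,
which reduce `p₂`, `p₂²`, `p₂³` to polynomials in `d` and `s = 2N+a`. Since the purity is bounded,
its cumulants are the usual polynomials in these moments, and `(N²-1)((N+a)²-1) = (d+1)² - s²`
leaves a rational identity in `d` and `s`. -/

/-! ### Dirichlet integrals on the simplex -/

section Dirichlet

open ENNReal

/-- The density `t ^ (b - 1) / Γ b` on `t > 0`, a convolution semigroup in `b`. -/
noncomputable def rieszDensity (b t : ℝ) : ℝ≥0∞ :=
  if 0 < t then ENNReal.ofReal (t ^ (b - 1) / Real.Gamma b) else 0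

theorem rieszDensity_of_pos {b t : ℝ} (ht : 0 < t) :
    rieszDensity b t = ENNReal.ofReal (t ^ (b - 1) / Real.Gamma b) := if_pos ht

theorem rieszDensity_of_nonpos {b t : ℝ} (ht : t ≤ 0) : rieszDensity b t = 0 :=
  if_neg ht.not_gt

@[fun_prop]
theorem measurable_rieszDensity (b : ℝ) : Measurable (rieszDensity b) :=
  Measurable.ite measurableSet_Ioi (by fun_prop) (by fun_prop)

theorem lintegral_comp_mul_left_of_pos {f : ℝ → ℝ≥0∞} (hf : Measurable f) {r : ℝ} (hr : 0 < r) :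
    ∫⁻ t, f t = ENNReal.ofReal r * ∫⁻ u, f (r * u) := by
  rw [← lintegral_map hf (measurable_const_mul r), Real.map_volume_mul_left hr.ne',
    lintegral_smul_measure, smul_eq_mul, ← mul_assoc, ← ENNReal.ofReal_mul hr.le,
    abs_of_pos (inv_pos.2 hr), mul_inv_cancel₀ hr.ne', ENNReal.ofReal_one, one_mul]

/-- The beta integral as a convolution identity. -/
theorem lintegral_rieszDensity_mul_rieszDensity_sub {b c : ℝ} (hb : 0 < b) (hc : 0 < c) (r : ℝ) :
    ∫⁻ t, rieszDensity b t * rieszDensity c (r - t) = rieszDensity (b + c) r := by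
  rcases le_or_gt r 0 with hr | hr
  · rw [rieszDensity_of_nonpos hr]
    refine (lintegral_congr fun t => ?_).trans lintegral_zero
    rcases le_or_gt t 0 with ht | ht
    · rw [rieszDensity_of_nonpos ht, zero_mul]
    · rw [rieszDensity_of_nonpos (t := r - t) (by linarith), mul_zero]
  have hΓ := Real.Gamma_pos_of_pos (add_pos hb hc)
  have hΓb := Real.Gamma_pos_of_pos hb
  have hΓc := Real.Gamma_pos_of_pos hc
  -- Substituting `t = r u` leaves a multiple of the beta density; the Jacobian supplies the
  -- remaining power of `r`.
  have hpt : ∀ u, rieszDensity b (r * u) * rieszDensity c (r - r * u) =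
      ENNReal.ofReal (r ^ (b + c - 2) / Real.Gamma (b + c)) * ProbabilityTheory.betaPDF b c u := by
    intro u
    rcases le_or_gt u 0 with hu | hu
    · rw [rieszDensity_of_nonpos (mul_nonpos_of_nonneg_of_nonpos hr.le hu), zero_mul,
        ProbabilityTheory.betaPDF_eq_zero_of_nonpos hu, mul_zero]
    rcases le_or_gt 1 u with hu1 | hu1
    · rw [rieszDensity_of_nonpos (t := r - r * u) (by nlinarith), mul_zero,
        ProbabilityTheory.betaPDF_eq_zero_of_one_le hu1, mul_zero]
    have h1u : 0 < 1 - u := by linarith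
    rw [show r - r * u = r * (1 - u) by ring, rieszDensity_of_pos (by positivity),
      rieszDensity_of_pos (by positivity), ProbabilityTheory.betaPDF_of_pos_lt_one hu hu1,
      ← ENNReal.ofReal_mul (by positivity), ← ENNReal.ofReal_mul (by positivity),
      Real.mul_rpow hr.le hu.le, Real.mul_rpow hr.le h1u.le,
      show b + c - 2 = (b - 1) + (c - 1) by ring, Real.rpow_add hr, ProbabilityTheory.beta]
    congr 1
    field_simp
  rw [lintegral_comp_mul_left_of_pos (by fun_prop) hr, lintegral_congr hpt,
    lintegral_const_mul' _ _ ENNReal.ofReal_ne_top,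
    ProbabilityTheory.lintegral_betaPDF_eq_one hb hc, mul_one, rieszDensity_of_pos hr,
    ← ENNReal.ofReal_mul hr.le]
  congr 1
  rw [show b + c - 1 = 1 + (b + c - 2) by ring, Real.rpow_add hr, Real.rpow_one]
  ring

/-- The Dirichlet integral. -/
theorem lintegral_rieszDensity_sub_sum_mul_prod {M : ℕ} {c : ℝ} (hc : 0 < c) {b : Fin M → ℝ}
    (hb : ∀ i, 0 < b i) (r : ℝ) :
    ∫⁻ x : Fin M → ℝ, rieszDensity c (r - ∑ i, x i) * ∏ i, rieszDensity (b i) (x i) =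
      rieszDensity (c + ∑ i, b i) r := by
  induction M generalizing r with
  | zero => simp [volume_pi]
  | succ M ih =>
    rw [← ((volume_preserving_piFinSuccAbove (fun _ : Fin (M + 1) => ℝ) 0).symm).lintegral_comp
      (by fun_prop), Measure.volume_eq_prod, lintegral_prod _ (by fun_prop)]
    simp only [MeasurableEquiv.piFinSuccAbove_symm_apply, Fin.insertNthEquiv_zero,
      Fin.consEquiv_apply, Fin.sum_univ_succ, Fin.prod_univ_succ, Fin.cons_zero, Fin.cons_succ]
    -- With the first coordinate fixed at `t`, the rest is the same integral with total `r - t`.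
    have hinner : ∀ t : ℝ, ∫⁻ y : Fin M → ℝ, rieszDensity c (r - (t + ∑ i, y i)) *
        (rieszDensity (b 0) t * ∏ i, rieszDensity (b i.succ) (y i)) =
        rieszDensity (b 0) t * rieszDensity (c + ∑ i : Fin M, b i.succ) (r - t) := by
      intro t
      rw [← ih (fun i => hb i.succ), ← lintegral_const_mul _ (by fun_prop)]
      refine lintegral_congr fun y => ?_
      rw [sub_sub, mul_left_comm]
    rw [lintegral_congr hinner, lintegral_rieszDensity_mul_rieszDensity_sub (hb 0)
      (add_pos_of_pos_of_nonneg hc (Finset.sum_nonneg fun i _ => (hb _).le))]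
    congr 1
    ring

/-- The Dirichlet integral over the simplex `∑ λ_l = 1`. -/
theorem lintegral_traceOneMeasure_prod_rieszDensity {M : ℕ} {b : Fin (M + 1) → ℝ}
    (hb : ∀ i, 0 < b i) :
    ∫⁻ x, ∏ i, rieszDensity (b i) (x i) ∂traceOneMeasure (M + 1) =
      ENNReal.ofReal (1 / Real.Gamma (∑ i, b i)) := by
  rw [traceOneMeasure, lintegral_map (by fun_prop) measurable_traceOnePoint]
  simp only [traceOnePoint, Fin.prod_univ_succ, Fin.cons_zero, Fin.cons_succ]
  rw [lintegral_rieszDensity_sub_sum_mul_prod (hb 0) fun i => hb i.succ, Fin.sum_univ_succ,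
    rieszDensity_of_pos one_pos, Real.one_rpow]

theorem measurableSet_pos (N : ℕ) : MeasurableSet {x : Fin N → ℝ | ∀ l, 0 < x l} := by
  rw [Set.ofPred_forall]
  exact MeasurableSet.iInter fun l => measurableSet_lt measurable_const (measurable_pi_apply l)

theorem lintegral_traceOneMeasure_prod_rpow {M : ℕ} {b : Fin (M + 1) → ℝ}
    (hb : ∀ i, 0 < b i) :
    ∫⁻ x in {x | ∀ l, 0 < x l}, ENNReal.ofReal (∏ i, x i ^ (b i - 1)) ∂traceOneMeasure (M + 1) =
      ENNReal.ofReal ((∏ i, Real.Gamma (b i)) / Real.Gamma (∑ i, b i)) := by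
  have hΓ : ∀ i, 0 < Real.Gamma (b i) := fun i => Real.Gamma_pos_of_pos (hb i)
  have hP : 0 < ∏ i, Real.Gamma (b i) := Finset.prod_pos fun i _ => hΓ i
  rw [div_eq_mul_one_div, ENNReal.ofReal_mul hP.le,
    ← lintegral_traceOneMeasure_prod_rieszDensity hb, ← lintegral_const_mul _ (by fun_prop),
    ← lintegral_indicator (measurableSet_pos _)]
  refine lintegral_congr fun x => ?_
  by_cases hx : ∀ l, 0 < x l
  · rw [Set.indicator_of_mem (by exact hx),
      Finset.prod_congr rfl fun i _ => rieszDensity_of_pos (hx i),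
      ← ENNReal.ofReal_prod_of_nonneg fun i _ =>
        div_nonneg (Real.rpow_nonneg (hx i).le _) (hΓ i).le,
      ← ENNReal.ofReal_mul hP.le, Finset.prod_div_distrib, mul_div_cancel₀ _ hP.ne']
  · rw [Set.indicator_of_notMem (by exact hx)]
    push Not at hx
    obtain ⟨l, hl⟩ := hx
    have h0 : ∏ i, rieszDensity (b i) (x i) = 0 :=
      Finset.prod_eq_zero (Finset.mem_univ l) (rieszDensity_of_nonpos hl)
    rw [h0, mul_zero]

end Dirichlet

/-! ### The Gamma functional and integration by parts -/

/-- The linear functional on polynomials sending `X ^ m` to `∏ Γ (a + 1 + mᵢ)`, i.e. integration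
against `∏ xᵢ ^ a * exp (-xᵢ)` on the positive orthant. -/
noncomputable def gammaFunctional (N : ℕ) (a : ℝ) : MvPolynomial (Fin N) ℝ →ₗ[ℝ] ℝ :=
  (MvPolynomial.basisMonomials (Fin N) ℝ).constr ℝ fun m => ∏ i, Real.Gamma (a + 1 + m i)

namespace MvPolynomial

variable {N : ℕ} {a : ℝ}

theorem gammaFunctional_monomial (m : Fin N →₀ ℕ) (c : ℝ) :
    gammaFunctional N a (monomial m c) = c * ∏ i, Real.Gamma (a + 1 + m i) := by
  have h : monomial m c = c • (basisMonomials (Fin N) ℝ m : MvPolynomial (Fin N) ℝ) := by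
    simp [smul_monomial]
  rw [h, map_smul, gammaFunctional, Module.Basis.constr_basis, smul_eq_mul]

/-- Integration by parts in one coordinate. -/
theorem gammaFunctional_X_mul (ha : -1 < a) (i : Fin N) (Q : MvPolynomial (Fin N) ℝ) :
    gammaFunctional N a (X i * Q) =
      (a + 1) * gammaFunctional N a Q + gammaFunctional N a (X i * pderiv i Q) := by
  induction Q using MvPolynomial.induction_on' with
  | add p q hp hq => simp only [mul_add, map_add, hp, hq]; ring
  | monomial m c =>
    rw [X_mul_pderiv_monomial, map_nsmul, X, monomial_mul, gammaFunctional_monomial,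
      gammaFunctional_monomial, ← Finset.mul_prod_erase Finset.univ _ (Finset.mem_univ i),
      ← Finset.mul_prod_erase Finset.univ (fun j => Real.Gamma (a + 1 + m j)) (Finset.mem_univ i)]
    have h1 : ∀ j ∈ Finset.univ.erase i,
        Real.Gamma (a + 1 + ((Finsupp.single i 1 + m : Fin N →₀ ℕ) j : ℕ)) = Real.Gamma (a + 1 + m j) := by
      intro j hj
      rw [Finsupp.add_apply, Finsupp.single_eq_of_ne (Finset.ne_of_mem_erase hj), zero_add]
    -- The functional equation of Gamma is the whole content; `a > -1` keeps its argument nonzero.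
    have h2 : Real.Gamma (a + 1 + ((Finsupp.single i 1 + m : Fin N →₀ ℕ) i : ℕ)) =
        (a + 1 + m i) * Real.Gamma (a + 1 + m i) := by
      rw [← Real.Gamma_add_one (by have : (0:ℝ) ≤ m i := Nat.cast_nonneg _; linarith)]
      congr 1
      simp
      ring
    rw [Finset.prod_congr rfl h1, h2, nsmul_eq_mul]
    ring

/-! ### Power vector fields and the Vandermonde determinant -/

/-- The vector field `∑ xᵢ ^ (k + 1) ∂ᵢ`. -/
noncomputable def powerField (N k : ℕ) :
    Derivation ℝ (MvPolynomial (Fin N) ℝ) (MvPolynomial (Fin N) ℝ) :=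
  mkDerivation ℝ fun i => X i ^ (k + 1)

theorem powerField_eq_sum (k : ℕ) (Q : MvPolynomial (Fin N) ℝ) :
    powerField N k Q = ∑ i, X i ^ (k + 1) * pderiv i Q := by
  have : powerField N k = ∑ i, (X i ^ (k + 1) : MvPolynomial (Fin N) ℝ) • pderiv i := by
    refine derivation_ext fun j => ?_
    rw [powerField, mkDerivation_X, ← Derivation.coeFnAddMonoidHom_apply, map_sum,
      Finset.sum_apply, Finset.sum_eq_single j]
    · simp [Derivation.coeFnAddMonoidHom]
    · intro i _ hij
      simp [Derivation.coeFnAddMonoidHom, pderiv_X_of_ne hij.symm]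
    · simp
  rw [this, ← Derivation.coeFnAddMonoidHom_apply, map_sum, Finset.sum_apply]
  simp [Derivation.coeFnAddMonoidHom]

/-- Power sums are stable under these fields, so the loop equations become a recursion among
products of power sums. -/
theorem powerField_psum (k n : ℕ) :
    powerField N k (psum (Fin N) ℝ n) = (n : ℝ) • psum (Fin N) ℝ (n + k) := by
  rcases n with - | n
  · simp
  simp only [psum, map_sum, Finset.smul_sum]
  refine Finset.sum_congr rfl fun i _ => ?_
  rw [Derivation.leibniz_pow, powerField, mkDerivation_X, Nat.add_sub_cancel, smul_eq_mul,
    ← pow_add, ← Nat.cast_smul_eq_nsmul ℝ]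
  congr 2
  ring

/-- The Vandermonde determinant `∏_{j < k} (x_k - x_j)`. -/
noncomputable def vandermondePoly (N : ℕ) : MvPolynomial (Fin N) ℝ :=
  ∏ j, ∏ k ∈ Finset.Ioi j, (X k - X j)

/-- Logarithmic derivatives add over a product. -/
theorem _root_.Derivation.map_prod_of_eigen {R A ι : Type*} [CommRing R] [CommRing A] [Algebra R A]
    (D : Derivation R A A) (s : Finset ι) (f c : ι → A) (h : ∀ i ∈ s, D (f i) = c i * f i) :
    D (∏ i ∈ s, f i) = (∑ i ∈ s, c i) * ∏ i ∈ s, f i := by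
  classical
  induction s using Finset.induction_on with
  | empty => simp
  | insert i s hi ih =>
    rw [Finset.prod_insert hi, Finset.sum_insert hi, Derivation.leibniz,
      ih fun j hj => h j (Finset.mem_insert_of_mem hj), h i (Finset.mem_insert_self i s)]
    simp only [smul_eq_mul]
    ring

/-- Each factor `x_j - x_i` divides its image `x_j^(k+1) - x_i^(k+1)`, with a geometric sum as
quotient. -/
theorem powerField_vandermondePoly (k : ℕ) :
    powerField N k (vandermondePoly N) =
      (∑ i, ∑ j ∈ Finset.Ioi i, ∑ l ∈ Finset.range (k + 1), X j ^ l * X i ^ (k - l)) *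
        vandermondePoly N := by
  refine Derivation.map_prod_of_eigen _ _ _ _ fun i _ =>
    Derivation.map_prod_of_eigen _ _ _ _ fun j _ => ?_
  rw [map_sub, powerField, mkDerivation_X, mkDerivation_X, ← (Commute.all _ _).geom_sum₂_mul]
  simp

/-- The summand is symmetric in `i, j`, so twice the sum over pairs is the full double sum minus the
diagonal, where all `k + 1` terms equal `x_i^k`. -/
theorem two_mul_sum_Ioi_eq (k : ℕ) :
    2 * (∑ i : Fin N, ∑ j ∈ Finset.Ioi i, ∑ l ∈ Finset.range (k + 1),
        (X j ^ l * X i ^ (k - l) : MvPolynomial (Fin N) ℝ)) =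
      ∑ l ∈ Finset.range (k + 1), psum (Fin N) ℝ l * psum (Fin N) ℝ (k - l) -
        (k + 1 : MvPolynomial (Fin N) ℝ) * psum (Fin N) ℝ k := by
  set h : Fin N → Fin N → MvPolynomial (Fin N) ℝ := fun i j =>
    ∑ l ∈ Finset.range (k + 1), X j ^ l * X i ^ (k - l) with hh
  have hsymm : ∀ i j, h i j = h j i := by
    intro i j
    simp only [hh]
    rw [← Finset.sum_range_reflect]
    refine Finset.sum_congr rfl fun l hl => ?_
    have := Finset.mem_range.1 hl
    rw [mul_comm]
    congr 2
    omega
  have hall : ∑ i, ∑ j, h i j =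
      ∑ l ∈ Finset.range (k + 1), psum (Fin N) ℝ l * psum (Fin N) ℝ (k - l) := by
    simp only [hh, psum, Finset.sum_mul_sum]
    rw [Finset.sum_comm]
    simp_rw [Finset.sum_comm (s := Finset.univ) (t := Finset.range (k + 1))]
  have hdiag : ∑ i, h i i = (k + 1 : MvPolynomial (Fin N) ℝ) * psum (Fin N) ℝ k := by
    simp only [hh, psum, Finset.mul_sum]
    refine Finset.sum_congr rfl fun i _ => ?_
    rw [Finset.sum_congr rfl (g := fun _ => (X i ^ k : MvPolynomial (Fin N) ℝ))]
    · simp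
    · intro l hl
      have := Finset.mem_range.1 hl
      rw [← pow_add]
      congr 1
      omega
  have hsplit : ∀ i, ∑ j, h i j = ∑ j ∈ Finset.Iio i, h i j + h i i + ∑ j ∈ Finset.Ioi i, h i j := by
    intro i
    rw [← Finset.sum_filter_add_sum_filter_not Finset.univ (fun j => j ≤ i)]
    congr 1
    · rw [add_comm, ← Finset.sum_insert (by simp)]
      refine Finset.sum_congr ?_ fun _ _ => rfl
      ext j
      simp [le_iff_eq_or_lt]
    · refine Finset.sum_congr ?_ fun _ _ => rfl
      ext j
      simp
  have hflip : ∑ i, ∑ j ∈ Finset.Iio i, h i j = ∑ i, ∑ j ∈ Finset.Ioi i, h i j := by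
    rw [Finset.sum_comm' (t' := Finset.univ) (s' := fun j => Finset.Ioi j) (by simp)]
    exact Finset.sum_congr rfl fun i _ => Finset.sum_congr rfl fun j _ => hsymm _ _
  rw [← hall, ← hdiag, Finset.sum_congr rfl fun i _ => hsplit i, Finset.sum_add_distrib,
    Finset.sum_add_distrib, hflip]
  ring

/-! ### Loop equations -/

/-- Unnormalised expectation of a polynomial in the Laguerre unitary ensemble. -/
noncomputable def laguerreFunctional (N : ℕ) (a : ℝ) : MvPolynomial (Fin N) ℝ →ₗ[ℝ] ℝ :=
  gammaFunctional N a ∘ₗ LinearMap.mulLeft ℝ (vandermondePoly N ^ 2)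

theorem laguerreFunctional_apply (F : MvPolynomial (Fin N) ℝ) :
    laguerreFunctional N a F = gammaFunctional N a (vandermondePoly N ^ 2 * F) := rfl

theorem gammaFunctional_psum_succ_mul (ha : -1 < a) (k : ℕ) (Q : MvPolynomial (Fin N) ℝ) :
    gammaFunctional N a (psum (Fin N) ℝ (k + 1) * Q) =
      (a + 1 + k) * gammaFunctional N a (psum (Fin N) ℝ k * Q) +
        gammaFunctional N a (powerField N k Q) := by
  rw [powerField_eq_sum]
  simp only [psum, Finset.sum_mul, map_sum, Finset.mul_sum]
  rw [← Finset.sum_add_distrib]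
  refine Finset.sum_congr rfl fun i _ => ?_
  rw [pow_succ', mul_assoc, gammaFunctional_X_mul ha, Derivation.leibniz, Derivation.leibniz_pow,
    pderiv_X_self]
  have h : (X i : MvPolynomial (Fin N) ℝ) *
      ((X i ^ k : MvPolynomial (Fin N) ℝ) • pderiv i Q +
        Q • k • (X i ^ (k - 1) : MvPolynomial (Fin N) ℝ) • (1 : MvPolynomial (Fin N) ℝ)) =
      X i ^ (k + 1) * pderiv i Q + (k : ℝ) • (X i ^ k * Q) := by
    rcases k with - | k
    · simp
    · simp only [smul_eq_mul, Algebra.smul_def, Nat.add_sub_cancel]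
      push_cast
      simp
      ring
  rw [h, map_add, map_smul, smul_eq_mul]
  ring_nf

/-- The loop equations of the Laguerre unitary ensemble. -/
theorem laguerreFunctional_psum_succ_mul (ha : -1 < a) (k : ℕ) (F : MvPolynomial (Fin N) ℝ) :
    laguerreFunctional N a (psum (Fin N) ℝ (k + 1) * F) =
      a * laguerreFunctional N a (psum (Fin N) ℝ k * F) +
      laguerreFunctional N a
        ((∑ l ∈ Finset.range (k + 1), psum (Fin N) ℝ l * psum (Fin N) ℝ (k - l)) * F) +
      laguerreFunctional N a (powerField N k F) := by
  -- The diagonal term `-(k+1) p_k` cancels against the factor `a + 1 + k` from integration by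
  -- parts, leaving `a`.
  have hD : powerField N k (vandermondePoly N ^ 2 * F) =
      vandermondePoly N ^ 2 * powerField N k F +
      vandermondePoly N ^ 2 * ((∑ l ∈ Finset.range (k + 1),
        psum (Fin N) ℝ l * psum (Fin N) ℝ (k - l)) * F) -
        ((k : ℝ) + 1) • (vandermondePoly N ^ 2 * (psum (Fin N) ℝ k * F)) := by
    rw [Derivation.leibniz, Derivation.leibniz_pow, powerField_vandermondePoly]
    have := two_mul_sum_Ioi_eq (N := N) k
    rw [eq_sub_iff_add_eq] at this
    rw [← this]
    simp only [smul_eq_mul, Algebra.smul_def]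
    simp
    ring
  simp only [laguerreFunctional_apply]
  rw [mul_left_comm, gammaFunctional_psum_succ_mul ha, hD, map_sub, map_add, map_smul, smul_eq_mul,
    mul_left_comm (psum _ _ k)]
  ring

theorem psum_zero_eq : psum (Fin N) ℝ 0 = C (N : ℝ) := by
  simp

/-! ### Laguerre averages of powers of `p₂` -/

section Moments

/-- For `k = 0` the field is Euler's: on homogeneous `F`, a factor `p₁` contributes `d + deg F`. -/
theorem laguerreFunctional_psum_one_mul (ha : -1 < a) (F : MvPolynomial (Fin N) ℝ) :
    laguerreFunctional N a (psum (Fin N) ℝ 1 * F) =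
      N * (N + a) * laguerreFunctional N a F + laguerreFunctional N a (powerField N 0 F) := by
  have := laguerreFunctional_psum_succ_mul ha 0 F
  simp only [zero_add, Finset.sum_range_one, Nat.sub_self, psum_zero_eq, smul_mul_assoc, C_mul', map_smul,
    smul_eq_mul] at this
  rw [this]
  ring

theorem laguerreFunctional_psum_two_mul (ha : -1 < a) (F : MvPolynomial (Fin N) ℝ) :
    laguerreFunctional N a (psum (Fin N) ℝ 2 * F) =
      (2 * N + a) * laguerreFunctional N a (psum (Fin N) ℝ 1 * F) +
        laguerreFunctional N a (powerField N 1 F) := by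
  have := laguerreFunctional_psum_succ_mul ha 1 F
  simp only [Nat.reduceAdd, Finset.sum_range_succ, Finset.sum_range_zero, zero_add, psum_zero_eq,
    Nat.sub_zero, Nat.sub_self, mul_comm _ (C (N : ℝ)), add_mul, mul_assoc, map_add] at this
  simp only [C_mul', map_smul, smul_eq_mul] at this
  rw [this]
  ring

theorem laguerreFunctional_psum_three_mul (ha : -1 < a) (F : MvPolynomial (Fin N) ℝ) :
    laguerreFunctional N a (psum (Fin N) ℝ 3 * F) =
      (2 * N + a) * laguerreFunctional N a (psum (Fin N) ℝ 2 * F) +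
        laguerreFunctional N a (psum (Fin N) ℝ 1 * (psum (Fin N) ℝ 1 * F)) +
        laguerreFunctional N a (powerField N 2 F) := by
  have := laguerreFunctional_psum_succ_mul ha 2 F
  simp only [Nat.reduceAdd, Nat.reduceSub, Finset.sum_range_succ, Finset.sum_range_zero, zero_add,
    psum_zero_eq, Nat.sub_zero, Nat.sub_self, mul_comm _ (C (N : ℝ)), add_mul, mul_assoc,
    map_add] at this
  simp only [C_mul', map_smul, smul_eq_mul] at this
  rw [this]
  ring

theorem laguerreFunctional_psum_four_mul (ha : -1 < a) (F : MvPolynomial (Fin N) ℝ) :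
    laguerreFunctional N a (psum (Fin N) ℝ 4 * F) =
      (2 * N + a) * laguerreFunctional N a (psum (Fin N) ℝ 3 * F) +
        2 * laguerreFunctional N a (psum (Fin N) ℝ 1 * (psum (Fin N) ℝ 2 * F)) +
        laguerreFunctional N a (powerField N 3 F) := by
  have := laguerreFunctional_psum_succ_mul ha 3 F
  simp only [Nat.reduceAdd, Nat.reduceSub, Finset.sum_range_succ, Finset.sum_range_zero, zero_add,
    psum_zero_eq, Nat.sub_zero, Nat.sub_self, mul_comm _ (C (N : ℝ)), add_mul, mul_assoc,
    map_add, mul_left_comm (psum _ _ 2) (psum _ _ 1)] at this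
  simp only [C_mul', map_smul, smul_eq_mul] at this
  rw [this]
  ring

variable (N a) in
theorem laguerreFunctional_psum_two_pow_one (ha : -1 < a) :
    laguerreFunctional N a (psum (Fin N) ℝ 2) =
      (2 * N + a) * (N * (N + a)) * laguerreFunctional N a 1 := by
  have h1 := laguerreFunctional_psum_one_mul (N := N) ha 1
  have h2 := laguerreFunctional_psum_two_mul (N := N) ha 1
  simp only [mul_one, Derivation.map_one_eq_zero, map_zero, add_zero] at h1 h2
  rw [h2, h1]
  ring

variable (N a) in
theorem laguerreFunctional_psum_two_pow_two (ha : -1 < a) :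
    laguerreFunctional N a (psum (Fin N) ℝ 2 ^ 2) =
      (N * (N + a)) * ((2 * N + a) ^ 2 * (N * (N + a) + 4) + 2 * (N * (N + a) + 1)) *
        laguerreFunctional N a 1 := by
  have e1 := laguerreFunctional_psum_one_mul (N := N) ha (psum (Fin N) ℝ 2)
  have e2 := laguerreFunctional_psum_two_mul (N := N) ha (psum (Fin N) ℝ 2)
  have e3 := laguerreFunctional_psum_three_mul (N := N) ha 1
  have e4 := laguerreFunctional_psum_one_mul (N := N) ha (psum (Fin N) ℝ 1)
  have e5 := laguerreFunctional_psum_one_mul (N := N) ha 1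
  have e6 := laguerreFunctional_psum_two_pow_one N a ha
  simp only [mul_one, Derivation.map_one_eq_zero, map_zero, add_zero, powerField_psum, map_smul,
    smul_eq_mul, Nat.reduceAdd, Nat.cast_ofNat, Nat.cast_one, one_mul] at e1 e2 e3 e4 e5
  rw [sq, e2, e1, e3, e4, e5, e6]
  ring

variable (N a) in
-- Peeling off one `p₂` differentiates `p₂²` into `4 p₂p₃`; peeling off `p₃` then creates `2 p₄`.
-- All other factors are removed by the lower loop equations.
theorem laguerreFunctional_psum_two_pow_three (ha : -1 < a) :
    laguerreFunctional N a (psum (Fin N) ℝ 2 ^ 3) =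
      (N * (N + a)) * ((2 * N + a) * (N * (N + a) + 8) *
          ((2 * N + a) ^ 2 * (N * (N + a) + 4) + 2 * (N * (N + a) + 1)) +
        4 * (2 * N + a) * ((N * (N + a) + 2) * (N * (N + a) + 3) + 2 * (2 * N + a) ^ 2 +
          2 * (N * (N + a) + 1) + 4 * (N * (N + a) + 2))) *
        laguerreFunctional N a 1 := by
  have e1 := laguerreFunctional_psum_two_mul (N := N) ha (psum (Fin N) ℝ 2 * psum (Fin N) ℝ 2)
  have e2 := laguerreFunctional_psum_one_mul (N := N) ha (psum (Fin N) ℝ 2 * psum (Fin N) ℝ 2)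
  have e3 := laguerreFunctional_psum_three_mul (N := N) ha (psum (Fin N) ℝ 2)
  have e4 := laguerreFunctional_psum_one_mul (N := N) ha (psum (Fin N) ℝ 1 * psum (Fin N) ℝ 2)
  have e5 := laguerreFunctional_psum_one_mul (N := N) ha (psum (Fin N) ℝ 2)
  have e6 := laguerreFunctional_psum_four_mul (N := N) ha 1
  have e7 := laguerreFunctional_psum_three_mul (N := N) ha 1
  have e8 := laguerreFunctional_psum_one_mul (N := N) ha (psum (Fin N) ℝ 1)
  have e9 := laguerreFunctional_psum_one_mul (N := N) ha 1
  have e10 := laguerreFunctional_psum_two_pow_one N a ha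
  have e11 := laguerreFunctional_psum_two_pow_two N a ha
  simp only [mul_one, Derivation.map_one_eq_zero, map_zero, add_zero, powerField_psum, map_smul,
    smul_eq_mul, Nat.reduceAdd, Nat.cast_ofNat, Nat.cast_one, one_mul, Derivation.leibniz,
    map_add, mul_smul_comm, mul_comm (psum (Fin N) ℝ 2) (psum (Fin N) ℝ 1),
    mul_comm (psum (Fin N) ℝ 2) (psum (Fin N) ℝ 3)]
    at e1 e2 e3 e4 e5 e6 e7 e8 e9
  rw [sq] at e11
  rw [pow_succ', sq]
  rw [e1, e2, e3, e4, e6, e7, e8, e9, e5, e11, e10]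
  ring

end Moments

end MvPolynomial

/-! ### Cumulants from moments -/

section Cumulants

open ProbabilityTheory

variable {Ω : Type*} [MeasurableSpace Ω] {X : Ω → ℝ} {μ : Measure Ω}

theorem cumulant_one [IsProbabilityMeasure μ] (h : ∀ t, Integrable (fun ω => Real.exp (t * X ω)) μ) :
    cumulant X μ 1 = μ[X] := by
  have h0 : ∀ t, t ∈ interior (integrableExpSet X μ) := by
    simp [Set.eq_univ_of_forall (s := integrableExpSet X μ) h]
  rw [cumulant, iteratedDeriv_one, deriv_cgf_zero (h0 0)]
  simp

/-- Stated for all `t`, not just `0`, because it is differentiated again. -/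
theorem deriv_cgf_eq_div [IsProbabilityMeasure μ]
    (h : ∀ t, Integrable (fun ω => Real.exp (t * X ω)) μ) :
    deriv (cgf X μ) = fun t => iteratedDeriv 1 (mgf X μ) t / mgf X μ t := by
  have h0 : ∀ t, t ∈ interior (integrableExpSet X μ) := by
    simp [Set.eq_univ_of_forall (s := integrableExpSet X μ) h]
  funext t
  rw [iteratedDeriv_one]
  exact ((differentiableAt_mgf (h0 t)).hasDerivAt.log (mgf_pos (h t)).ne').deriv

theorem iteratedDeriv_two_cgf_eq_div [IsProbabilityMeasure μ]
    (h : ∀ t, Integrable (fun ω => Real.exp (t * X ω)) μ) :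
    iteratedDeriv 2 (cgf X μ) = fun t =>
      (iteratedDeriv 2 (mgf X μ) t * mgf X μ t - iteratedDeriv 1 (mgf X μ) t ^ 2) /
        mgf X μ t ^ 2 := by
  have h0 : ∀ t, t ∈ interior (integrableExpSet X μ) := by
    simp [Set.eq_univ_of_forall (s := integrableExpSet X μ) h]
  have hd : ∀ n t, HasDerivAt (iteratedDeriv n (mgf X μ)) (iteratedDeriv (n + 1) (mgf X μ) t) t := by
    intro n t
    rw [iteratedDeriv_succ]
    exact (differentiableAt_iteratedDeriv_mgf (h0 t) n).hasDerivAt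
  funext t
  have hd0 := hd 0 t
  rw [iteratedDeriv_zero] at hd0
  rw [iteratedDeriv_succ, iteratedDeriv_one, deriv_cgf_eq_div h,
    ((hd 1 t).fun_div hd0 (mgf_pos (h t)).ne').deriv]
  ring

theorem cumulant_two [IsProbabilityMeasure μ] (h : ∀ t, Integrable (fun ω => Real.exp (t * X ω)) μ) :
    cumulant X μ 2 = μ[X ^ 2] - μ[X] ^ 2 := by
  have h0 : 0 ∈ interior (integrableExpSet X μ) := by
    simp [Set.eq_univ_of_forall (s := integrableExpSet X μ) h]
  rw [cumulant, iteratedDeriv_two_cgf_eq_div h]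
  simp [iteratedDeriv_mgf_zero h0]

theorem cumulant_three [IsProbabilityMeasure μ]
    (h : ∀ t, Integrable (fun ω => Real.exp (t * X ω)) μ) :
    cumulant X μ 3 = μ[X ^ 3] - 3 * μ[X] * μ[X ^ 2] + 2 * μ[X] ^ 3 := by
  have h0 : ∀ t, t ∈ interior (integrableExpSet X μ) := by
    simp [Set.eq_univ_of_forall (s := integrableExpSet X μ) h]
  have hd : ∀ n t, HasDerivAt (iteratedDeriv n (mgf X μ)) (iteratedDeriv (n + 1) (mgf X μ) t) t := by
    intro n t
    rw [iteratedDeriv_succ]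
    exact (differentiableAt_iteratedDeriv_mgf (h0 t) n).hasDerivAt
  have hd0 := hd 0 0
  rw [iteratedDeriv_zero] at hd0
  have hpos := (mgf_pos (h 0)).ne'
  rw [cumulant, iteratedDeriv_succ, iteratedDeriv_two_cgf_eq_div h,
    ((((hd 2 0).fun_mul hd0).fun_sub ((hd 1 0).fun_pow 2)).fun_div (hd0.fun_pow 2)
      (pow_ne_zero 2 hpos)).deriv]
  simp [iteratedDeriv_mgf_zero (h0 0)]
  ring

end Cumulants

/-! ### From the Laguerre functional to the fixed trace ensemble -/

section FixedTrace

open MvPolynomial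

variable {M N : ℕ} {a : ℝ}

theorem prod_rpow_mul_prod_pow {x : Fin N → ℝ} (hx : ∀ l, 0 < x l) (m : Fin N → ℕ) :
    (∏ l, x l ^ a) * ∏ l, x l ^ m l = ∏ l, x l ^ (a + 1 + m l - 1) := by
  rw [← Finset.prod_mul_distrib]
  refine Finset.prod_congr rfl fun l _ => ?_
  rw [show a + 1 + m l - 1 = a + m l by ring, Real.rpow_add (hx l), Real.rpow_natCast]

theorem integrable_prod_rpow_mul_monomial_and_integral_eq (ha : -1 < a) (m : Fin (M + 1) →₀ ℕ) :
    Integrable (fun x : Fin (M + 1) → ℝ => (∏ l, x l ^ a) * ∏ l, x l ^ m l)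
      ((traceOneMeasure (M + 1)).restrict {x | ∀ l, 0 < x l}) ∧
    ∫ x : Fin (M + 1) → ℝ in {x | ∀ l, 0 < x l}, (∏ l, x l ^ a) * ∏ l, x l ^ m l
        ∂traceOneMeasure (M + 1) =
      (∏ l, Real.Gamma (a + 1 + m l)) / Real.Gamma ((M + 1 : ℕ) * (a + 1) + m.degree) := by
  have hb : ∀ l, 0 < a + 1 + m l := fun l => by
    have : (0 : ℝ) ≤ m l := Nat.cast_nonneg _
    linarith
  have hsum : ∑ l, (a + 1 + m l) = (M + 1 : ℕ) * (a + 1) + m.degree := by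
    rw [Finset.sum_add_distrib, Finsupp.degree_eq_sum]
    simp
    ring
  have hlint := lintegral_traceOneMeasure_prod_rpow hb
  rw [hsum] at hlint
  have hcongr : (fun x : Fin (M + 1) → ℝ => (∏ l, x l ^ a) * ∏ l, x l ^ m l)
      =ᵐ[(traceOneMeasure (M + 1)).restrict {x | ∀ l, 0 < x l}]
        fun x => ∏ l, x l ^ (a + 1 + m l - 1) :=
    (ae_restrict_mem (measurableSet_pos _)).mono fun x hx => prod_rpow_mul_prod_pow hx _
  have hnonneg : 0 ≤ᵐ[(traceOneMeasure (M + 1)).restrict {x | ∀ l, 0 < x l}]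
      fun x => ∏ l, x l ^ (a + 1 + m l - 1) :=
    (ae_restrict_mem (measurableSet_pos _)).mono fun x hx =>
      Finset.prod_nonneg fun l _ => Real.rpow_nonneg (hx l).le _
  have hmeas : Measurable fun x : Fin (M + 1) → ℝ => ∏ l, x l ^ (a + 1 + m l - 1) := by
    fun_prop
  constructor
  · rw [integrable_congr hcongr]
    refine ⟨hmeas.aestronglyMeasurable, ?_⟩
    rw [hasFiniteIntegral_iff_ofReal hnonneg, hlint]
    exact ENNReal.ofReal_lt_top
  · rw [integral_congr_ae hcongr,
      integral_eq_lintegral_of_nonneg_ae hnonneg hmeas.aestronglyMeasurable, hlint,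
      ENNReal.toReal_ofReal]
    refine div_nonneg (Finset.prod_nonneg fun l _ => (Real.Gamma_pos_of_pos (hb l)).le) ?_
    rw [← hsum]
    exact (Real.Gamma_pos_of_pos (Finset.sum_pos (fun l _ => hb l) Finset.univ_nonempty)).le

theorem prod_rpow_mul_eval_eq_sum (Q : MvPolynomial (Fin N) ℝ) (x : Fin N → ℝ) :
    (∏ l, x l ^ a) * eval x Q =
      ∑ m ∈ Q.support, coeff m Q * ((∏ l, x l ^ a) * ∏ l, x l ^ m l) := by
  rw [eval_eq', Finset.mul_sum]
  exact Finset.sum_congr rfl fun m _ => mul_left_comm _ _ _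

theorem integrable_prod_rpow_mul_eval (ha : -1 < a) (Q : MvPolynomial (Fin (M + 1)) ℝ) :
    Integrable (fun x : Fin (M + 1) → ℝ => (∏ l, x l ^ a) * eval x Q)
      ((traceOneMeasure (M + 1)).restrict {x | ∀ l, 0 < x l}) := by
  simp_rw [prod_rpow_mul_eval_eq_sum]
  exact integrable_finsetSum _ fun m _ =>
    (integrable_prod_rpow_mul_monomial_and_integral_eq ha m).1.const_mul _

/-- Homogeneity gives every monomial the same Gamma denominator, which therefore factors out. -/
theorem integral_prod_rpow_mul_eval (ha : -1 < a) {Q : MvPolynomial (Fin (M + 1)) ℝ} {n : ℕ}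
    (hQ : Q.IsHomogeneous n) :
    ∫ x : Fin (M + 1) → ℝ in {x | ∀ l, 0 < x l}, (∏ l, x l ^ a) * eval x Q
        ∂traceOneMeasure (M + 1) =
      gammaFunctional (M + 1) a Q / Real.Gamma ((M + 1 : ℕ) * (a + 1) + n) := by
  simp_rw [prod_rpow_mul_eval_eq_sum]
  rw [integral_finsetSum _ fun m _ =>
    (integrable_prod_rpow_mul_monomial_and_integral_eq ha m).1.const_mul _]
  conv_rhs => rw [Q.as_sum, map_sum, Finset.sum_div]
  refine Finset.sum_congr rfl fun m hm => ?_
  have hdeg : m.degree = n := by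
    rw [Finsupp.degree_eq_weight_one]
    exact hQ (mem_support_iff.1 hm)
  rw [integral_const_mul, (integrable_prod_rpow_mul_monomial_and_integral_eq ha m).2,
    gammaFunctional_monomial, hdeg, mul_div_assoc]

theorem laguerreWeight_eq (x : Fin N → ℝ) :
    laguerreWeight a x = (∏ l, x l ^ a) * eval x (vandermondePoly N ^ 2) := by
  simp [laguerreWeight, vandermondePoly, map_prod, Finset.prod_pow]

theorem measurable_laguerreWeight : Measurable (laguerreWeight a : (Fin N → ℝ) → ℝ) := by
  unfold laguerreWeight
  fun_prop

theorem laguerreWeight_nonneg {x : Fin N → ℝ} (hx : ∀ l, 0 < x l) : 0 ≤ laguerreWeight a x := by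
  rw [laguerreWeight_eq, map_pow]
  exact mul_nonneg (Finset.prod_nonneg fun l _ => Real.rpow_nonneg (hx l).le _) (sq_nonneg _)

theorem isHomogeneous_vandermondePoly_sq_mul {F : MvPolynomial (Fin N) ℝ} {n : ℕ}
    (hF : F.IsHomogeneous n) :
    (vandermondePoly N ^ 2 * F).IsHomogeneous (N * (N - 1) + n) := by
  have h : (vandermondePoly N).IsHomogeneous (∑ j : Fin N, (Finset.Ioi j).card) := by
    refine IsHomogeneous.prod _ _ _ fun j _ => ?_
    rw [Finset.card_eq_sum_ones]
    exact IsHomogeneous.prod _ _ _ fun k _ => (isHomogeneous_X _ _).sub (isHomogeneous_X _ _)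
  have hcard : (∑ j : Fin N, (Finset.Ioi j).card) * 2 = N * (N - 1) := by
    simp only [Fin.card_Ioi]
    rw [Fin.sum_univ_eq_sum_range (fun i => N - 1 - i), Finset.sum_range_reflect (fun i => i),
      Finset.sum_range_id_mul_two]
  rw [← hcard]
  exact (h.pow 2).mul hF

theorem integral_fixedTraceLUEUnnormalized_eval (ha : -1 < a)
    {F : MvPolynomial (Fin (M + 1)) ℝ} {n : ℕ} (hF : F.IsHomogeneous n) :
    ∫ x, eval x F ∂fixedTraceLUEUnnormalized (M + 1) a =
      laguerreFunctional (M + 1) a F /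
        Real.Gamma ((M + 1 : ℕ) * ((M + 1 : ℕ) + a) + n) := by
  rw [fixedTraceLUEUnnormalized, integral_withDensity_eq_integral_toReal_smul
    measurable_laguerreWeight.ennreal_ofReal (by simp)]
  have hcongr : ∀ᵐ x ∂(traceOneMeasure (M + 1)).restrict {x | ∀ l, 0 < x l},
      (ENNReal.ofReal (laguerreWeight a x)).toReal • eval x F =
        (∏ l, x l ^ a) * eval x (vandermondePoly (M + 1) ^ 2 * F) := by
    filter_upwards [ae_restrict_mem (measurableSet_pos _)] with x hx
    rw [ENNReal.toReal_ofReal (laguerreWeight_nonneg hx), laguerreWeight_eq, map_mul, smul_eq_mul,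
      mul_assoc]
  rw [integral_congr_ae hcongr,
    integral_prod_rpow_mul_eval ha (isHomogeneous_vandermondePoly_sq_mul hF),
    laguerreFunctional_apply]
  -- Exponent count: `N(a+1) + N(N-1) = N(N+a)`.
  congr 2
  push_cast [Nat.add_sub_cancel]
  ring

theorem fixedTraceLUEUnnormalized_univ_lt_top (ha : -1 < a) :
    fixedTraceLUEUnnormalized (M + 1) a Set.univ < ⊤ := by
  have h := integrable_prod_rpow_mul_eval ha (vandermondePoly (M + 1) ^ 2)
  simp_rw [← laguerreWeight_eq] at h
  rw [fixedTraceLUEUnnormalized, withDensity_apply _ MeasurableSet.univ, Measure.restrict_univ]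
  exact h.lintegral_lt_top

theorem continuous_traceOnePoint : Continuous (traceOnePoint : (Fin M → ℝ) → Fin (M + 1) → ℝ) := by
  unfold traceOnePoint
  fun_prop

theorem traceOnePoint_tail {x : Fin (M + 1) → ℝ} (hx : ∑ l, x l = 1) :
    traceOnePoint (Fin.tail x) = x := by
  rw [Fin.sum_univ_succ] at hx
  have h : 1 - ∑ i, Fin.tail x i = x 0 := by
    simp only [Fin.tail]
    linarith
  rw [traceOnePoint, h, Fin.cons_self_tail]

theorem sum_traceOnePoint (x : Fin M → ℝ) : ∑ l, traceOnePoint x l = 1 := by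
  simp [traceOnePoint, Fin.sum_univ_succ]

/-- The weight is positive on the open set of positive points with distinct coordinates; it suffices
that this set meets the simplex. -/
theorem fixedTraceLUEUnnormalized_univ_pos :
    0 < fixedTraceLUEUnnormalized (M + 1) a Set.univ := by
  rw [fixedTraceLUEUnnormalized, withDensity_apply _ MeasurableSet.univ, Measure.restrict_univ,
    setLIntegral_pos_iff measurable_laguerreWeight.ennreal_ofReal]
  set U : Set (Fin (M + 1) → ℝ) :=
    {x | eval x (vandermondePoly (M + 1)) ≠ 0} ∩ {x | ∀ l, 0 < x l} with hU
  have hUopen : IsOpen U := by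
    refine (isOpen_ne_fun (continuous_eval _) continuous_const).inter ?_
    rw [Set.ofPred_forall]
    exact isOpen_iInter_of_finite fun l => isOpen_lt continuous_const (continuous_apply l)
  have hUsub : U ⊆ Function.support (fun x => ENNReal.ofReal (laguerreWeight a x)) ∩
      {x : Fin (M + 1) → ℝ | ∀ l, 0 < x l} := by
    rintro x ⟨hV, hx⟩
    refine ⟨?_, hx⟩
    rw [Function.mem_support, ENNReal.ofReal_ne_zero_iff, laguerreWeight_eq, map_pow]
    exact mul_pos (Finset.prod_pos fun l _ => Real.rpow_pos_of_pos (hx l) _)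
      (sq_pos_iff.2 hV)
  refine lt_of_lt_of_le ?_ (measure_mono hUsub)
  rw [traceOneMeasure, Measure.map_apply measurable_traceOnePoint hUopen.measurableSet]
  refine (hUopen.preimage continuous_traceOnePoint).measure_pos _ ?_
  set S : ℝ := ∑ l : Fin (M + 1), ((l : ℝ) + 1) with hS
  have hSpos : 0 < S := Finset.sum_pos (fun l _ => by positivity) Finset.univ_nonempty
  -- Coordinates proportional to `1, …, N` are positive and distinct, and dividing by `S` makes the
  -- trace one.
  refine ⟨Fin.tail fun l : Fin (M + 1) => ((l : ℝ) + 1) / S, ?_⟩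
  rw [Set.mem_preimage, traceOnePoint_tail (by rw [← Finset.sum_div, ← hS, div_self hSpos.ne'])]
  refine ⟨?_, fun l => by positivity⟩
  simp only [vandermondePoly, map_prod, map_sub, eval_X, Set.mem_ofPred_eq]
  refine Finset.prod_ne_zero_iff.2 fun j _ => Finset.prod_ne_zero_iff.2 fun k hk => ?_
  have hjk : (j : ℝ) < k := by exact_mod_cast Finset.mem_Ioi.1 hk
  rw [← sub_div]
  exact div_ne_zero (by linarith) hSpos.ne'

theorem isProbabilityMeasure_fixedTraceLUE (ha : -1 < a) :
    IsProbabilityMeasure (fixedTraceLUE (M + 1) a) :=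
  ⟨by rw [fixedTraceLUE, Measure.smul_apply, smul_eq_mul,
    ENNReal.inv_mul_cancel fixedTraceLUEUnnormalized_univ_pos.ne'
      (fixedTraceLUEUnnormalized_univ_lt_top ha).ne]⟩

theorem fixedTraceLUEUnnormalized_real_univ (ha : -1 < a) :
    (fixedTraceLUEUnnormalized (M + 1) a).real Set.univ =
      laguerreFunctional (M + 1) a 1 / Real.Gamma ((M + 1 : ℕ) * ((M + 1 : ℕ) + a)) := by
  have h := integral_fixedTraceLUEUnnormalized_eval ha (isHomogeneous_one (Fin (M + 1)) ℝ)
  simpa using h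

/-- Positivity of the total mass replaces an explicit evaluation of the partition function. -/
theorem laguerreFunctional_one_ne_zero (ha : -1 < a) : laguerreFunctional (M + 1) a 1 ≠ 0 := by
  intro h
  have h1 := fixedTraceLUEUnnormalized_real_univ (M := M) ha
  rw [h, zero_div, measureReal_eq_zero_iff (fixedTraceLUEUnnormalized_univ_lt_top ha).ne] at h1
  exact fixedTraceLUEUnnormalized_univ_pos.ne' h1

theorem integral_fixedTraceLUE_eval (ha : -1 < a)
    {F : MvPolynomial (Fin (M + 1)) ℝ} {n : ℕ} (hF : F.IsHomogeneous n) :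
    ∫ x, eval x F ∂fixedTraceLUE (M + 1) a =
      laguerreFunctional (M + 1) a F / laguerreFunctional (M + 1) a 1 *
        (Real.Gamma ((M + 1 : ℕ) * ((M + 1 : ℕ) + a)) /
          Real.Gamma ((M + 1 : ℕ) * ((M + 1 : ℕ) + a) + n)) := by
  rw [fixedTraceLUE, integral_smul_measure, integral_fixedTraceLUEUnnormalized_eval ha hF,
    ENNReal.toReal_inv, ← measureReal_def, fixedTraceLUEUnnormalized_real_univ ha, smul_eq_mul,
    inv_div, div_mul_div_comm, div_mul_div_comm, mul_comm (Real.Gamma _)]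

/-- On the simplex `0 < x_l ≤ 1`, so `x_l² ≤ x_l`. Boundedness makes all exponential moments finite.
-/
theorem ae_purity_mem_Icc : ∀ᵐ x ∂fixedTraceLUE (M + 1) a, purity x ∈ Set.Icc (0 : ℝ) 1 := by
  refine Measure.ae_smul_measure (withDensity_absolutelyContinuous _ _ ?_) _
  have hsum : ∀ᵐ x ∂traceOneMeasure (M + 1), ∑ l, x l = 1 := by
    rw [traceOneMeasure, ae_map_iff measurable_traceOnePoint.aemeasurable
      (measurableSet_eq_fun (by fun_prop) measurable_const)]
    exact Filter.Eventually.of_forall sum_traceOnePoint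
  filter_upwards [ae_restrict_mem (measurableSet_pos _), ae_restrict_of_ae hsum] with x hx h1
  refine ⟨Finset.sum_nonneg fun _ _ => sq_nonneg _, ?_⟩
  rw [purity, ← h1]
  refine Finset.sum_le_sum fun l _ => ?_
  have hle : x l ≤ 1 := by
    rw [← h1]
    exact Finset.single_le_sum (fun i _ => (hx i).le) (Finset.mem_univ l)
  nlinarith [hx l]

theorem measurable_purity : Measurable (purity : (Fin N → ℝ) → ℝ) := by
  unfold purity
  fun_prop

theorem integral_fixedTraceLUE_purity_pow (ha : -1 < a) (n : ℕ) :
    ∫ x, purity x ^ n ∂fixedTraceLUE (M + 1) a =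
      laguerreFunctional (M + 1) a (psum (Fin (M + 1)) ℝ 2 ^ n) / laguerreFunctional (M + 1) a 1 *
        (Real.Gamma ((M + 1 : ℕ) * ((M + 1 : ℕ) + a)) /
          Real.Gamma ((M + 1 : ℕ) * ((M + 1 : ℕ) + a) + (2 * n : ℕ))) := by
  have hp : (psum (Fin (M + 1)) ℝ 2).IsHomogeneous 2 :=
    IsHomogeneous.sum _ _ _ fun i _ => isHomogeneous_X_pow i 2
  rw [← integral_fixedTraceLUE_eval ha (hp.pow n)]
  simp [purity, psum]

end FixedTrace

/-! ### Assembling the three cumulants -/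

theorem Real.Gamma_add_natCast_eq_prod_mul {d : ℝ} (hd : 0 < d) (n : ℕ) :
    Real.Gamma (d + n) = (∏ k ∈ Finset.range n, (d + k)) * Real.Gamma d := by
  induction n with
  | zero => simp
  | succ n ih =>
    rw [Nat.cast_succ, ← add_assoc, Real.Gamma_add_one (by positivity), ih,
      Finset.prod_range_succ]
    ring

theorem corollary3p2 (N : ℕ) (hN : 1 ≤ N) (a : ℝ) (ha : -1 < a) :
    IsProbabilityMeasure (fixedTraceLUE N a) ∧
    cumulant purity (fixedTraceLUE N a) 1 = (2 * N + a) / (N * (N + a) + 1) ∧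
    cumulant purity (fixedTraceLUE N a) 2 =
      2 * ((N : ℝ) ^ 2 - 1) * ((N + a) ^ 2 - 1) /
        ((N * (N + a) + 1) ^ 2 * (N * (N + a) + 2) * (N * (N + a) + 3)) ∧
    cumulant purity (fixedTraceLUE N a) 3 =
      8 * ((N : ℝ) ^ 2 - 1) * ((N + a) ^ 2 - 1) * (2 * N + a) * (N * (N + a) - 5) /
        ((N * (N + a) + 1) ^ 3 * (N * (N + a) + 2) * (N * (N + a) + 3) *
          (N * (N + a) + 4) * (N * (N + a) + 5)) := by
  obtain ⟨M, rfl⟩ : ∃ M, N = M + 1 := ⟨N - 1, by omega⟩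
  have hprob := isProbabilityMeasure_fixedTraceLUE (M := M) ha
  have hint : ∀ t, Integrable (fun x => Real.exp (t * purity x)) (fixedTraceLUE (M + 1) a) :=
    fun t => ProbabilityTheory.integrable_exp_mul_of_mem_Icc measurable_purity.aemeasurable
      ae_purity_mem_Icc
  have hZ := laguerreFunctional_one_ne_zero (M := M) ha
  have hNa : 0 < ((M + 1 : ℕ) : ℝ) * ((M + 1 : ℕ) + a) := by
    have : (0 : ℝ) ≤ M := Nat.cast_nonneg M
    push_cast
    exact mul_pos (by linarith) (by linarith)
  have m1 := integral_fixedTraceLUE_purity_pow (M := M) ha 1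
  have m2 := integral_fixedTraceLUE_purity_pow (M := M) ha 2
  have m3 := integral_fixedTraceLUE_purity_pow (M := M) ha 3
  simp only [pow_one] at m1
  rw [MvPolynomial.laguerreFunctional_psum_two_pow_one _ _ ha,
    Real.Gamma_add_natCast_eq_prod_mul hNa] at m1
  rw [MvPolynomial.laguerreFunctional_psum_two_pow_two _ _ ha,
    Real.Gamma_add_natCast_eq_prod_mul hNa] at m2
  rw [MvPolynomial.laguerreFunctional_psum_two_pow_three _ _ ha,
    Real.Gamma_add_natCast_eq_prod_mul hNa] at m3
  simp only [Nat.reduceMul, Finset.prod_range_succ, Finset.prod_range_zero, Nat.cast_ofNat,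
    Nat.cast_zero, Nat.cast_one, add_zero, one_mul, mul_one] at m1 m2 m3
  have hprod : (((M + 1 : ℕ) : ℝ) ^ 2 - 1) * (((M + 1 : ℕ) + a) ^ 2 - 1) =
      (((M + 1 : ℕ) : ℝ) * ((M + 1 : ℕ) + a) + 1) ^ 2 - (2 * (M + 1 : ℕ) + a) ^ 2 := by
    ring
  rw [cumulant_one hint, cumulant_two hint, cumulant_three hint, mul_assoc 2, mul_assoc 8, hprod]
  simp only [Pi.pow_apply]
  rw [m1, m2, m3]
  have hΓ := (Real.Gamma_pos_of_pos hNa).ne'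
  generalize Real.Gamma (((M + 1 : ℕ) : ℝ) * ((M + 1 : ℕ) + a)) = G at *
  generalize MvPolynomial.laguerreFunctional (M + 1) a 1 = Z at *
  generalize ((M + 1 : ℕ) : ℝ) * ((M + 1 : ℕ) + a) = d at *
  generalize 2 * ((M + 1 : ℕ) : ℝ) + a = s at *
  refine ⟨hprob, ?_, ?_, ?_⟩
  · field_simp
  · field_simp
    ring
  · field_simp
    ring
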